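/- A group is CSA if all of its maximal abelian subgroups are malnormal. Let $\Gamma=G\rtimes_\alpha\langle t\rangle$ be a semidirect product with $\langle t\rangle$ infinite cyclic. A $\Gamma$-tree is a simplicial tree with an action of $\Gamma$ without edge inversions; it is minimal if it has no proper nonempty $\Gamma$-invariant subtree. Let $T$ be a $\Gamma$-tree that is bipartite in such a way that the $\Gamma$-stabilizers of the vertices of one colour (the black vertices) are abelian and those of the other colour (the white vertices) are not abelian. One says that $\Gamma$ is a piecewise trivial suspension over $(G,T)$ if for every vertex $v$ of $T$ there is an element $t_v\in Gt$ such that $\mathrm{Stab}_\Gamma(v)$ is the internal direct product $\mathrm{Stab}_G(v)\times\langle t_v\rangle$ and such that, if $v$ is white, the fixed point set of every nontrivial power of $t_v$ is exactly the ball of radius $2$ around $v$. **Proposition.** Suppose that a group $\Gamma$ contains CSA subgroups $G,G'$ such that \[G\rtimes_\alpha\langle t\rangle=\Gamma=G'\rtimes_{\alpha'}\langle t'\rangle ,\] and that $\Gamma$ is a piecewise trivial suspension over both $(G,T)$ and $(G',T')$, where $T$ and $T'$ are minimal $\Gamma$-trees. Then there is a $\Gamma$-equivariant isomorphism of trees $f:T\to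 T'$. -/

import Mathlib

namespace PiecewiseTrivial

/-- A subgroup `M` is malnormal if `g M g⁻¹ ∩ M` is trivial for every `g ∉ M`. -/
def IsMalnormal {G : Type*} [Group G] (M : Subgroup G) : Prop :=
  ∀ g : G, g ∉ M → ∀ x : G, x ∈ M → g * x * g⁻¹ ∈ M → x = 1

/-- A group is CSA if all of its maximal abelian subgroups are malnormal. -/
def IsCSA (G : Type*) [Group G] : Prop :=
  ∀ M : Subgroup G, Maximal (fun A : Subgroup G => IsMulCommutative A) M → IsMalnormal M

/-- `Γ = G ⋊_α ⟨t⟩` as an internal semidirect product: `G` is normal, `⟨t⟩` is an infinite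
cyclic complement of `G`, and the conjugation `g ↦ t⁻¹ g t` induces `α` on `G`. -/
structure IsSuspension {Γ : Type*} [Group Γ] (G : Subgroup Γ) (α : MulAut G) (t : Γ) :
    Prop where
  normal : G.Normal
  isComplement : Subgroup.IsComplement' G (Subgroup.zpowers t)
  infinite_order : ¬ IsOfFinOrder t
  conj_eq : ∀ g : G, t⁻¹ * (g : Γ) * t = (α g : Γ)

/-- A `Γ`-tree: a tree with an action of `Γ` by graph automorphisms, without edge inversion. -/
structure IsGroupTree (Γ : Type*) [Group Γ] {V : Type*} [MulAction Γ V] (T : SimpleGraph V) :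
    Prop where
  isTree : T.IsTree
  adj_smul : ∀ (g : Γ) (v w : V), T.Adj v w → T.Adj (g • v) (g • w)
  no_inversion : ∀ (g : Γ) (v w : V), T.Adj v w → ¬ (g • v = w ∧ g • w = v)

/-- The `Γ`-tree `T` is minimal: it has no proper (nonempty) `Γ`-invariant subtree. Subtrees of a
tree are given by the sets of vertices that induce a connected subgraph. -/
def IsMinimalTree (Γ : Type*) [Group Γ] {V : Type*} [MulAction Γ V] (T : SimpleGraph V) : Prop :=
  ∀ S : Set V, (T.induce S).Connected → (∀ (g : Γ), ∀ v ∈ S, g • v ∈ S) → S = Set.univ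

/-- Black vertices are those with abelian stabilizer in `Γ`; the others are white. -/
def IsBlack (Γ : Type*) [Group Γ] {V : Type*} [MulAction Γ V] (v : V) : Prop :=
  IsMulCommutative (MulAction.stabilizer Γ v)

/-- `T` is bipartite with respect to the class of abelian subgroups: there is a bipartition of its
vertices for which the stabilizers of one colour are abelian and those of the other colour are not.
Such a bipartition can only be the one into black and white vertices. -/
def IsAbelianBipartite (Γ : Type*) [Group Γ] {V : Type*} [MulAction Γ V] (T : SimpleGraph V) :
    Prop :=
  ∀ v w : V, T.Adj v w → (IsBlack Γ v ↔ ¬ IsBlack Γ w)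

/-- The subgroup `C` is the internal direct product of its subgroups `A` and `B`. -/
structure IsInternalDirectProduct {Γ : Type*} [Group Γ] (C A B : Subgroup Γ) : Prop where
  sup_eq : A ⊔ B = C
  inf_eq : A ⊓ B = ⊥
  comm : ∀ a ∈ A, ∀ b ∈ B, a * b = b * a

/-- For `Γ = G ⋊ ⟨t⟩` and a `Γ`-tree `T`: `Γ` is a piecewise trivial suspension over `(G, T)`.
Each vertex `v` has an element `t_v` in the coset `G t` such that `Stab_Γ(v)` is the direct product
of `Stab_G(v)` and `⟨t_v⟩`, and if `v` is white then every nontrivial power of `t_v` fixes exactly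
the ball of radius `2` around `v`. -/
structure IsPiecewiseTrivialSuspension {Γ : Type*} [Group Γ] (G : Subgroup Γ) (t : Γ)
    {V : Type*} [MulAction Γ V] (T : SimpleGraph V) : Prop where
  isGroupTree : IsGroupTree Γ T
  bipartite : IsAbelianBipartite Γ T
  exists_central : ∀ v : V, ∃ tv : Γ, (∃ g ∈ G, tv = g * t) ∧
    IsInternalDirectProduct (MulAction.stabilizer Γ v) (MulAction.stabilizer Γ v ⊓ G)
      (Subgroup.zpowers tv) ∧
    (¬ IsBlack Γ v → ∀ n : ℤ, n ≠ 0 → ∀ w : V, tv ^ n • w = w ↔ T.dist v w ≤ 2)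

end PiecewiseTrivial

/-!
The tree is reconstructed from the group `Γ` alone. A nontrivial power of `t_v`, `v` white, has as
fixed point set the ball of radius `2` around `v`; as this ball determines `v`, the centralizer of
the power is the stabilizer of `v`, which is not abelian. Conversely, every element `x ≠ 1` with a
nonabelian centralizer is a nontrivial power of some `t_v`:

* an element of `G` that fixes two edges at a white vertex is trivial, since otherwise commutative
  transitivity of `G` would produce white vertices `w`, `u` at distance `4` with commuting `t_w`,
  `t_u`; hence so is an element of `G` that fixes two vertices at distance at least `3`;
* if `x` has no fixed point, then it translates an axis, its centralizer acts on this axis by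
  translations, and commutators of the centralizer are elements of `G` that fix the axis, so that
  the centralizer is abelian;
* if `x` has a fixed point and is not a power of any `t_v`, then the centralizer of `x` has a fixed
  vertex `u`, so that it is abelian by commutative transitivity in
  `Stab_Γ(u) = Stab_G(u) × ⟨t_u⟩`.

So the stabilizers of the white vertices are the nonabelian centralizers of nontrivial elements.
Since there are no leaves, the black vertices are the maximal sets of white vertices with pairwise
distances at most `2`, and white vertices `v`, `w` are at distance at most `2` if and only if an
element with centralizer `Stab_Γ(v)` lies in `Stab_Γ(w)`.
-/

namespace PiecewiseTrivial

open scoped commutatorElement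

section Trees

variable {V : Type*} {T : SimpleGraph V}

theorem exists_adj_dist_add_one (hT : T.Connected) {r x : V} (hx : x ≠ r) :
    ∃ y, T.Adj x y ∧ T.dist r y + 1 = T.dist r x := by
  obtain ⟨w, hw⟩ := hT.exists_walk_length_eq_dist x r
  cases w with
  | nil => exact absurd rfl hx
  | @cons _ y _ hxy w =>
    refine ⟨y, hxy, ?_⟩
    have hyr : T.dist y r ≤ w.length := SimpleGraph.dist_le w
    have hxr := hT.dist_triangle (u := x) (v := y) (w := r)
    rw [SimpleGraph.dist_eq_one_iff_adj.2 hxy] at hxr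
    rw [SimpleGraph.Walk.length_cons] at hw
    rw [T.dist_comm (u := r) (v := y), T.dist_comm (u := r) (v := x)]
    lia

theorem eq_of_adj_of_dist_lt (hT : T.IsTree) {r x y z : V} (hy : T.Adj x y) (hz : T.Adj x z)
    (hyr : T.dist r y < T.dist r x) (hzr : T.dist r z < T.dist r x) : y = z := by
  have exists_path : ∀ y, T.Adj x y → T.dist r y < T.dist r x →
      ∃ w : T.Walk x r, w.IsPath ∧ w.snd = y := by
    intro y hy hyr
    obtain ⟨w, hw⟩ := hT.connected.exists_walk_length_eq_dist y r
    refine ⟨SimpleGraph.Walk.cons hy w, SimpleGraph.Walk.isPath_of_length_eq_dist _ ?_,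
      SimpleGraph.Walk.snd_cons w hy⟩
    have := hT.dist_eq_dist_add_one_of_adj r hy
    rw [SimpleGraph.Walk.length_cons, hw, T.dist_comm (u := x), T.dist_comm (u := y)]
    lia
  obtain ⟨w, hw, rfl⟩ := exists_path y hy hyr
  obtain ⟨w', hw', rfl⟩ := exists_path z hz hzr
  rw [(hT.existsUnique_path x r).unique hw hw']

theorem dist_eq_add_one_of_adj (hT : T.IsTree) {r x y z : V} (hy : T.Adj x y) (hz : T.Adj x z)
    (hyr : T.dist r y < T.dist r x) (hyz : y ≠ z) : T.dist r z = T.dist r x + 1 := by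
  have := hT.dist_eq_dist_add_one_of_adj r hz
  by_contra h
  exact hyz (eq_of_adj_of_dist_lt hT hy hz hyr (by lia))

theorem dist_eq_two (hT : T.IsTree) {x y z : V} (hy : T.Adj x y) (hz : T.Adj x z)
    (hyz : y ≠ z) : T.dist y z = 2 := by
  have hyx : T.dist y x = 1 := SimpleGraph.dist_eq_one_iff_adj.2 hy.symm
  rw [dist_eq_add_one_of_adj hT hy hz (by simp [hyx]) hyz, hyx]

theorem dist_getVert_getVert {x y : V} {w : T.Walk x y} (hw : w.length = T.dist x y) {i j : ℕ}
    (hij : i ≤ j) (hj : j ≤ w.length) : T.dist (w.getVert i) (w.getVert j) = j - i := by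
  have hsub : ((w.drop i).take (j - i)).IsSubwalk w :=
    ((w.drop i).isSubwalk_take _).trans (w.isSubwalk_drop i)
  have hend : (w.drop i).getVert (j - i) = w.getVert j := by
    rw [SimpleGraph.Walk.drop_getVert, Nat.add_sub_cancel' hij]
  rw [← hend, ← SimpleGraph.length_eq_dist_of_subwalk hw hsub]
  simp only [SimpleGraph.Walk.take_length, SimpleGraph.Walk.drop_length]
  lia

theorem induce_connected_of_forall_exists_adj {S : Set V} {r : V} (hr : r ∈ S)
    (hS : ∀ u ∈ S, u ≠ r → ∃ w ∈ S, T.Adj u w ∧ T.dist r w < T.dist r u) :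
    (T.induce S).Connected := by
  have reachable : ∀ (n : ℕ) (u : V) (hu : u ∈ S), T.dist r u = n →
      (T.induce S).Reachable ⟨u, hu⟩ ⟨r, hr⟩ := by
    intro n
    induction n using Nat.strong_induction_on with
    | _ n ih =>
      intro u hu hn
      by_cases hur : u = r
      · subst hur
        rfl
      obtain ⟨w, hw, huw, hlt⟩ := hS u hu hur
      have hadj : (T.induce S).Adj ⟨u, hu⟩ ⟨w, hw⟩ := huw
      exact hadj.reachable.trans (ih _ (hn ▸ hlt) w hw rfl)
  have : Nonempty S := ⟨⟨r, hr⟩⟩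
  exact ⟨fun u v => (reachable _ u u.2 rfl).trans (reachable _ v v.2 rfl).symm⟩

end Trees

section Lines

variable {V : Type*} {T : SimpleGraph V}

/-- A bi-infinite path without backtracking, given by its sequence of vertices. In a tree this is
a geodesic line (`IsLine.dist_eq_abs_sub`). -/
structure IsLine (T : SimpleGraph V) (p : ℤ → V) : Prop where
  adj : ∀ n, T.Adj (p n) (p (n + 1))
  ne : ∀ n, p n ≠ p (n + 2)

/-- The distance from the vertex `x` to the set of values of `p`. -/
noncomputable def distToRange (T : SimpleGraph V) (p : ℤ → V) (x : V) : ℕ := ⨅ n, T.dist x (p n)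

theorem exists_dist_eq_distToRange (T : SimpleGraph V) (p : ℤ → V) (x : V) :
    ∃ m, T.dist x (p m) = distToRange T p x :=
  ciInf_mem fun n => T.dist x (p n)

theorem distToRange_le (T : SimpleGraph V) (p : ℤ → V) (x : V) (n : ℤ) :
    distToRange T p x ≤ T.dist x (p n) :=
  ciInf_le' _ n

namespace IsLine

variable {p : ℤ → V}

theorem neg (hp : IsLine T p) : IsLine T fun n => p (-n) where
  adj n := by simpa [add_comm] using (hp.adj (-(n + 1))).symm
  ne n := by simpa [add_comm] using (hp.ne (-(n + 2))).symm

theorem dist_add_natCast (hp : IsLine T p) (hT : T.IsTree) {x : V} {m : ℤ}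
    (hm : T.dist x (p m) ≤ T.dist x (p (m + 1))) (k : ℕ) :
    T.dist x (p (m + k)) = T.dist x (p m) + k := by
  have dist_succ : ∀ k : ℕ, T.dist x (p (m + k + 1)) = T.dist x (p (m + k)) + 1 := by
    intro k
    induction k with
    | zero =>
      have := hT.dist_eq_dist_add_one_of_adj x (hp.adj m)
      simp only [Nat.cast_zero, add_zero]
      lia
    | succ k ih =>
      rw [Nat.cast_succ, ← add_assoc]
      refine dist_eq_add_one_of_adj hT (hp.adj (m + k)).symm (hp.adj _) (by lia) ?_
      simpa [add_assoc] using hp.ne (m + k)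
  induction k with
  | zero => simp
  | succ k ih => rw [Nat.cast_succ, ← add_assoc, dist_succ, ih, add_assoc]

theorem dist_eq_add_abs_sub (hp : IsLine T p) (hT : T.IsTree) {x : V} {m : ℤ}
    (hm : ∀ n, T.dist x (p m) ≤ T.dist x (p n)) (n : ℤ) :
    (T.dist x (p n) : ℤ) = T.dist x (p m) + |n - m| := by
  rcases le_total m n with h | h
  · obtain ⟨k, rfl⟩ := Int.exists_add_of_le h
    rw [hp.dist_add_natCast hT (hm _), add_sub_cancel_left, Nat.abs_cast, Nat.cast_add]
  · obtain ⟨k, rfl⟩ := Int.exists_add_of_le h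
    have := hp.neg.dist_add_natCast hT (x := x) (m := -(n + k)) (by simpa using hm _) k
    simp only [neg_neg, neg_add_rev, neg_add_cancel_comm] at this
    simp [this]

theorem dist_eq_abs_sub (hp : IsLine T p) (hT : T.IsTree) (m n : ℤ) :
    (T.dist (p m) (p n) : ℤ) = |n - m| := by
  simpa using hp.dist_eq_add_abs_sub hT (x := p m) (m := m) (by simp) n

theorem injective (hp : IsLine T p) (hT : T.IsTree) : Function.Injective p := by
  intro m n hmn
  have := hp.dist_eq_abs_sub hT m n
  rw [hmn, SimpleGraph.dist_self, Nat.cast_zero, eq_comm, abs_eq_zero] at this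
  lia

theorem eq_of_adj_of_distToRange_le (hp : IsLine T p) (hT : T.IsTree) {x y z : V}
    (hx : 0 < distToRange T p x) (hy : T.Adj x y) (hz : T.Adj x z)
    (hyx : distToRange T p y ≤ distToRange T p x) (hzx : distToRange T p z ≤ distToRange T p x) :
    y = z := by
  obtain ⟨m, hm⟩ := exists_dist_eq_distToRange T p x
  obtain ⟨r, hxr, hr⟩ := exists_adj_dist_add_one hT.connected (r := p m) (x := x) (by
    rintro rfl
    simp [← hm] at hx)
  have eq_r : ∀ y, T.Adj x y → distToRange T p y ≤ distToRange T p x → y = r := by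
    intro y hy hyx
    obtain ⟨k, hk⟩ := exists_dist_eq_distToRange T p y
    have hxk := hp.dist_eq_add_abs_sub hT (hm.trans_le <| distToRange_le T p x ·) k
    have hrk := hT.connected.dist_triangle (u := p k) (v := p m) (w := r)
    have hmk := hp.dist_eq_abs_sub hT k m
    have hxy := hT.dist_eq_dist_add_one_of_adj (p k) hy
    rw [T.dist_comm (u := x), T.dist_comm (u := x), abs_sub_comm] at hxk
    rw [T.dist_comm] at hm hk
    have := abs_nonneg (m - k)
    exact eq_of_adj_of_dist_lt hT (r := p k) hy hxr (by lia) (by lia)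
  rw [eq_r y hy hyx, eq_r z hz hzx]

end IsLine

end Lines

section GroupTrees

variable {Γ : Type*} [Group Γ] {V : Type*} [MulAction Γ V] {T : SimpleGraph V}

theorem IsGroupTree.adj_smul_iff (hT : IsGroupTree Γ T) (g : Γ) (x y : V) :
    T.Adj (g • x) (g • y) ↔ T.Adj x y :=
  ⟨fun h => by simpa using hT.adj_smul g⁻¹ _ _ h, hT.adj_smul g x y⟩

theorem IsGroupTree.dist_smul (hT : IsGroupTree Γ T) (g : Γ) (x y : V) :
    T.dist (g • x) (g • y) = T.dist x y := by
  have dist_le : ∀ (g : Γ) (x y : V), T.dist (g • x) (g • y) ≤ T.dist x y := by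
    intro g x y
    obtain ⟨w, hw⟩ := hT.isTree.connected.exists_walk_length_eq_dist x y
    let φ : T →g T := ⟨fun v => g • v, fun {a b} h => hT.adj_smul g a b h⟩
    have := SimpleGraph.dist_le (w.map φ)
    rwa [SimpleGraph.Walk.length_map, hw] at this
  refine le_antisymm (dist_le g x y) ?_
  simpa using dist_le g⁻¹ (g • x) (g • y)

theorem IsGroupTree.exists_adj_fixed (hT : IsGroupTree Γ T) {r x : V} (hx : x ≠ r) :
    ∃ y, T.Adj x y ∧ T.dist r y + 1 = T.dist r x ∧
      ∀ g : Γ, g • r = r → g • x = x → g • y = y := by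
  obtain ⟨y, hxy, hy⟩ := exists_adj_dist_add_one hT.isTree.connected hx
  refine ⟨y, hxy, hy, fun g hgr hgx => ?_⟩
  have hgy : T.dist r (g • y) = T.dist r y := by rw [← hT.dist_smul g r y, hgr]
  have hxgy : T.Adj x (g • y) := by simpa [hgx] using hT.adj_smul g x y hxy
  exact eq_of_adj_of_dist_lt hT.isTree (r := r) hxgy hxy (by lia) (by lia)

theorem exists_equivariant_int_extension {c : Γ} {l : ℕ} (hl : 0 < l) (f : ℕ → V)
    (hf : f l = c • f 0) :
    ∃ p : ℤ → V, (∀ n, p (n + l) = c • p n) ∧ ∀ i ≤ l, p i = f i := by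
  have hl' : (l : ℤ) ≠ 0 := by lia
  refine ⟨fun n => c ^ (n / (l : ℤ)) • f (n % l).toNat, fun n => ?_, fun i hi => ?_⟩
  · simp only [Int.add_ediv_of_dvd_right dvd_rfl, Int.ediv_self hl', Int.add_emod_right]
    rw [add_comm, zpow_add, zpow_one, mul_smul]
  · rcases hi.lt_or_eq with hi | rfl
    · simp [Int.ediv_eq_zero_of_lt, Int.emod_eq_of_lt, hi]
    · simp [Int.ediv_self hl', hf]

/-- The union of the translates under `⟨c⟩` of a geodesic from `p 0` to `c • p 0` is a line when
`p 0` is displaced by `c` as little as possible. -/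
theorem IsGroupTree.isLine_of_forall_le_dist_smul (hT : IsGroupTree Γ T) {c : Γ} {l : ℕ}
    (hl : 0 < l) {p : ℤ → V} (hp : ∀ n, p (n + l) = c • p n)
    (hdist : ∀ i j : ℕ, i ≤ j → j ≤ l → T.dist (p i) (p j) = j - i)
    (hmin : ∀ y, l ≤ T.dist y (c • y)) : IsLine T p := by
  have hadj : Function.Periodic (fun n => T.Adj (p n) (p (n + 1))) (l : ℤ) := fun n => by
    simp only [add_right_comm n (l : ℤ), hp, hT.adj_smul_iff]
  have hne : Function.Periodic (fun n => p n ≠ p (n + 2)) (l : ℤ) := fun n => by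
    simp only [add_right_comm n (l : ℤ), hp, ne_eq, smul_left_cancel_iff]
  have hl' : (0 : ℤ) < l := by lia
  refine ⟨fun n => ?_, fun n => ?_⟩
  · obtain ⟨i, ⟨hi, hil⟩, hni⟩ := hadj.exists_mem_Ico₀ hl' n
    lift i to ℕ using hi
    have := hdist i (i + 1) (by lia) (by lia)
    rw [Nat.add_sub_cancel_left, SimpleGraph.dist_eq_one_iff_adj] at this
    exact hni.mpr this
  · obtain ⟨i, ⟨hi, hil⟩, hni⟩ := hne.exists_mem_Ico₀ hl' n
    lift i to ℕ using hi
    refine hni.mpr fun heq => ?_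
    by_cases hi2 : i + 2 ≤ l
    · have := hdist i (i + 2) (by lia) hi2
      simp [← heq] at this
    have hturn : p i = c • p (1 : ℕ) := by
      rw [heq, ← hp, Nat.cast_one, show (i : ℤ) + 2 = 1 + l by lia]
    by_cases h1 : l = 1
    · have hi0 : i = 0 := by lia
      have hp1 : p (1 : ℕ) = c • p (0 : ℕ) := by simpa [h1] using hp 0
      rw [hi0] at hturn
      refine hT.no_inversion c (p (0 : ℕ)) (p (1 : ℕ)) ?_ ⟨hp1.symm, hturn.symm⟩
      rw [← SimpleGraph.dist_eq_one_iff_adj, hdist 0 1 zero_le_one h1.ge]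
    · have := hdist 1 i (by lia) (by lia)
      have := hmin (p (1 : ℕ))
      rw [← hturn] at this
      lia

theorem IsGroupTree.exists_axis (hT : IsGroupTree Γ T) {c : Γ} (hc : ∀ x : V, c • x ≠ x) :
    ∃ (l : ℕ) (p : ℤ → V), 0 < l ∧ IsLine T p ∧ ∀ n, p (n + l) = c • p n := by
  have hconn := hT.isTree.connected
  have : Nonempty V := hconn.nonempty
  obtain ⟨x, hx⟩ := ciInf_mem fun x : V => T.dist x (c • x)
  have hmin : ∀ y, T.dist x (c • x) ≤ T.dist y (c • y) := fun y => hx.trans_le (ciInf_le' _ y)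
  obtain ⟨w, hw⟩ := hconn.exists_walk_length_eq_dist x (c • x)
  have hl : 0 < w.length := hw ▸ hconn.pos_dist_of_ne (hc x).symm
  obtain ⟨p, hp, hpw⟩ := exists_equivariant_int_extension hl w.getVert (c := c) (by simp)
  refine ⟨w.length, p, hl, hT.isLine_of_forall_le_dist_smul hl hp ?_ (by rwa [hw]), hp⟩
  intro i j hij hj
  rw [hpw i (hij.trans hj), hpw j hj, dist_getVert_getVert hw hij hj]

theorem IsGroupTree.distToRange_smul (hT : IsGroupTree Γ T) {c : Γ} {l : ℤ} {p : ℤ → V}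
    (hp : ∀ n, p (n + l) = c • p n) (x : V) : distToRange T p (c • x) = distToRange T p x := by
  unfold distToRange
  rw [← (Equiv.addRight l).iInf_comp]
  simp only [Equiv.coe_addRight, hp, hT.dist_smul]

/-- The distance to the line `p` is bounded along `q`, hence has a maximum there, and at a maximum
off `p` the line `q` would have to turn back. -/
theorem IsGroupTree.exists_eq_of_translates (hT : IsGroupTree Γ T) {c : Γ} {l : ℕ} (hl : 0 < l)
    {p q : ℤ → V} (hp : IsLine T p) (hq : IsLine T q) (hpc : ∀ n, p (n + l) = c • p n)
    (hqc : ∀ n, q (n + l) = c • q n) (j : ℤ) : ∃ k, q j = p k := by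
  have hperiodic : Function.Periodic (fun n => distToRange T p (q n)) (l : ℤ) := fun n => by
    simp only [hqc, hT.distToRange_smul hpc]
  have hl' : (0 : ℤ) < l := by lia
  obtain ⟨m, -, hm⟩ := Finset.exists_max_image (Finset.Ico (0 : ℤ) l)
    (fun n => distToRange T p (q n)) (by simpa using hl)
  have hmax : ∀ n, distToRange T p (q n) ≤ distToRange T p (q m) := fun n => by
    obtain ⟨i, hi, hni⟩ := hperiodic.exists_mem_Ico₀ hl' n
    exact hni.trans_le (hm i (by simpa using hi))
  have hzero : distToRange T p (q m) = 0 := by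
    by_contra hpos
    have hadj := hq.adj (m - 1)
    have hne := hq.ne (m - 1)
    rw [sub_add_cancel] at hadj
    rw [show m - 1 + 2 = m + 1 by ring] at hne
    exact hne (hp.eq_of_adj_of_distToRange_le hT.isTree (Nat.pos_of_ne_zero hpos) hadj.symm
      (hq.adj m) (hmax _) (hmax _))
  obtain ⟨k, hk⟩ := exists_dist_eq_distToRange T p (q j)
  refine ⟨k, hT.isTree.connected.dist_eq_zero_iff.1 ?_⟩
  have := hmax j
  lia

theorem IsLine.smul (hT : IsGroupTree Γ T) {p : ℤ → V} (hp : IsLine T p)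
    (g : Γ) : IsLine T (g • p) where
  adj n := hT.adj_smul g _ _ (hp.adj n)
  ne n := (smul_left_cancel_iff g).ne.2 (hp.ne n)

theorem eq_add_of_isometry_of_add {s : ℤ → ℤ} {l : ℤ} (hl : 0 < l)
    (hs : ∀ i j, |s j - s i| = |j - i|) (hsl : ∀ n, s (n + l) = s n + l) (j : ℤ) :
    s j = j + s 0 := by
  have hmul : ∀ N : ℕ, s (N * l) = s 0 + N * l := by
    intro N
    induction N with
    | zero => simp
    | succ N ih => rw [Nat.cast_succ, add_one_mul, hsl, ih, add_assoc]
  have hfar : |j| < ((j.natAbs + 1 : ℕ) : ℤ) * l := by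
    rw [Nat.cast_succ, Int.natCast_natAbs]
    nlinarith [abs_nonneg j]
  have h0 := hs 0 j
  have hN := hs j (((j.natAbs + 1 : ℕ) : ℤ) * l)
  rw [hmul] at hN
  rw [abs_eq_abs] at h0 hN
  rw [abs_lt] at hfar
  lia

theorem IsGroupTree.exists_smul_eq_add_of_commute (hT : IsGroupTree Γ T) {c z : Γ} {l : ℕ}
    (hl : 0 < l) {p : ℤ → V} (hp : IsLine T p) (hpc : ∀ n, p (n + l) = c • p n) (hz : Commute z c) :
    ∃ k, ∀ j, z • p j = p (j + k) := by
  have hzc : ∀ n, (z • p) (n + l) = c • (z • p) n := fun n => by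
    simp only [Pi.smul_apply, hpc, ← mul_smul, hz.eq]
  choose s hs using hT.exists_eq_of_translates hl hp (hp.smul hT z) hpc hzc
  have hisom : ∀ i j, |s j - s i| = |j - i| := fun i j => by
    rw [← hp.dist_eq_abs_sub hT.isTree, ← hp.dist_eq_abs_sub hT.isTree, ← hs, ← hs]
    exact congrArg Nat.cast (hT.dist_smul z _ _)
  have hadd : ∀ n, s (n + l) = s n + l := fun n =>
    hp.injective hT.isTree (by rw [← hs, hzc, hs, hpc])
  exact ⟨s 0, fun j => (hs j).trans (by rw [eq_add_of_isometry_of_add (by lia) hisom hadd j])⟩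

/-- The axis of `c` is translated by both `a` and `b`, and translations commute. -/
theorem IsGroupTree.exists_commutator_smul_eq (hT : IsGroupTree Γ T) {a b c : Γ}
    (hc : ∀ x : V, c • x ≠ x) (ha : Commute a c) (hb : Commute b c) :
    ∃ x y : V, 3 ≤ T.dist x y ∧ ⁅a, b⁆ • x = x ∧ ⁅a, b⁆ • y = y := by
  obtain ⟨l, p, hl, hp, hpc⟩ := hT.exists_axis hc
  obtain ⟨i, hi⟩ := hT.exists_smul_eq_add_of_commute hl hp hpc ha
  obtain ⟨j, hj⟩ := hT.exists_smul_eq_add_of_commute hl hp hpc hb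
  have hfix : ∀ n, ⁅a, b⁆ • p n = p n := by
    intro n
    have hi' : a⁻¹ • p (n - j) = p (n - j - i) := by rw [inv_smul_eq_iff, hi, sub_add_cancel]
    have hj' : b⁻¹ • p n = p (n - j) := by rw [inv_smul_eq_iff, hj, sub_add_cancel]
    rw [commutatorElement_def, mul_smul, mul_smul, mul_smul, hj', hi', hj, hi]
    congr 1
    ring
  refine ⟨p 0, p 3, ?_, hfix 0, hfix 3⟩
  have := hp.dist_eq_abs_sub hT.isTree 0 3
  norm_num at this
  lia

end GroupTrees

section CommutativeTransitivity

/-- The group `G` is commutative transitive (a CT group): commutation is a transitive relation on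
its nontrivial elements. -/
def IsCommutativeTransitive (G : Type*) [Group G] : Prop :=
  ∀ x y z : G, x ≠ 1 → Commute y x → Commute z x → Commute y z

theorem exists_le_maximal_isMulCommutative {G : Type*} [Group G] (A : Subgroup G)
    (hA : IsMulCommutative A) :
    ∃ M, A ≤ M ∧ Maximal (fun B : Subgroup G => IsMulCommutative B) M := by
  refine zorn_le_nonempty₀ {B : Subgroup G | IsMulCommutative B} (fun c hc hchain B hB => ?_) A hA
  refine ⟨sSup c, ?_, fun _ => le_sSup⟩
  have : Nonempty c := ⟨⟨B, hB⟩⟩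
  have : ∀ C : c, IsMulCommutative (C : Subgroup G) := fun C => hc C.2
  rw [sSup_eq_iSup']
  exact Subgroup.isMulCommutative_iSup hchain.directed

theorem IsCSA.isCommutativeTransitive {G : Type*} [Group G] (hG : IsCSA G) :
    IsCommutativeTransitive G := by
  intro x y z hx hy hz
  have hxy : IsMulCommutative (Subgroup.closure {x, y}) := by
    refine Subgroup.isMulCommutative_closure ?_
    rintro a (rfl | rfl) b (rfl | rfl) <;> first | rfl | exact hy.eq | exact hy.eq.symm
  obtain ⟨M, hM, hmax⟩ := exists_le_maximal_isMulCommutative _ hxy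
  have hxM : x ∈ M := hM (Subgroup.subset_closure (by simp))
  have hyM : y ∈ M := hM (Subgroup.subset_closure (by simp))
  have hzM : z ∈ M := by
    by_contra h
    exact hx (hG M hmax z h x hxM (by rwa [hz.eq, mul_inv_cancel_right]))
  have : IsMulCommutative M := hmax.prop
  exact setLike_mul_comm hyM hzM

variable {Γ : Type*} [Group Γ] {G : Subgroup Γ}

theorem IsCommutativeTransitive.commute_of_mem (hG : IsCommutativeTransitive G) {x y z : Γ}
    (hxG : x ∈ G) (hyG : y ∈ G) (hzG : z ∈ G) (hx : x ≠ 1) (hy : Commute y x)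
    (hz : Commute z x) : Commute y z :=
  congrArg Subtype.val <| hG ⟨x, hxG⟩ ⟨y, hyG⟩ ⟨z, hzG⟩ (by simpa using hx) (Subtype.ext hy.eq)
    (Subtype.ext hz.eq)

variable {α : MulAut G} {t : Γ}

theorem IsSuspension.commutator_le (hs : IsSuspension G α t) : commutator Γ ≤ G :=
  have := hs.normal
  Subgroup.Normal.commutator_le_of_self_sup_commutative_eq_top hs.isComplement.sup_eq_top
    inferInstance

theorem IsSuspension.notMem (hs : IsSuspension G α t) : t ∉ G := by
  intro ht
  have := Subgroup.disjoint_def.1 hs.isComplement.disjoint ht (Subgroup.mem_zpowers t)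
  exact hs.infinite_order (this ▸ IsOfFinOrder.one)

end CommutativeTransitivity

section Colours

variable {Γ : Type*} [Group Γ] {V : Type*} [MulAction Γ V] {T : SimpleGraph V}

theorem IsBlack.commute {b : V} (hb : IsBlack Γ b) {x y : Γ} (hx : x • b = b) (hy : y • b = b) :
    Commute x y :=
  have : IsMulCommutative (MulAction.stabilizer Γ b) := hb
  setLike_mul_comm (s := MulAction.stabilizer Γ b) hx hy

theorem isBlack_iff {v : V} :
    IsBlack Γ v ↔ ∀ x y : Γ, x • v = v → y • v = v → Commute x y :=
  ⟨fun h _ _ => h.commute, fun h =>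
    isMulCommutative_iff.2 fun x y => Subtype.ext (h x y x.2 y.2)⟩

theorem isBlack_smul_iff (g : Γ) (v : V) : IsBlack Γ (g • v) ↔ IsBlack Γ v := by
  have smul : ∀ (g : Γ) (v : V), IsBlack Γ v → IsBlack Γ (g • v) := by
    intro g v hv
    refine isBlack_iff.2 fun x y hx hy => ?_
    have := hv.commute (x := g⁻¹ * x * g) (y := g⁻¹ * y * g) (by simp [mul_smul, hx])
      (by simp [mul_smul, hy])
    simpa [mul_assoc] using this.conj g
  exact ⟨fun h => by simpa using smul g⁻¹ _ h, smul g v⟩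

theorem IsAbelianBipartite.not_isBlack (hbip : IsAbelianBipartite Γ T) {b v : V}
    (hb : IsBlack Γ b) (hbv : T.Adj b v) : ¬ IsBlack Γ v := (hbip b v hbv).1 hb

theorem IsAbelianBipartite.isBlack (hbip : IsAbelianBipartite Γ T) {v b : V}
    (hv : ¬ IsBlack Γ v) (hvb : T.Adj v b) : IsBlack Γ b :=
  not_not.1 fun hb => hv ((hbip v b hvb).2 hb)

theorem IsAbelianBipartite.smul_ne_of_adj (hbip : IsAbelianBipartite Γ T) {x y : V}
    (hxy : T.Adj x y) (g : Γ) : g • x ≠ y := by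
  rintro rfl
  have := hbip x _ hxy
  rw [isBlack_smul_iff] at this
  tauto

theorem IsAbelianBipartite.eq_of_stabilizer_le (hbip : IsAbelianBipartite Γ T)
    (hT : IsGroupTree Γ T) {v w : V} (hv : ¬ IsBlack Γ v)
    (h : MulAction.stabilizer Γ v ≤ MulAction.stabilizer Γ w) : v = w := by
  by_contra hvw
  obtain ⟨b, hvb, -, hb⟩ := hT.exists_adj_fixed hvw
  exact hv <| isBlack_iff.2 fun x y hx hy =>
    (hbip.isBlack hv hvb).commute (hb x (h hx) hx) (hb y (h hy) hy)

/-- No vertex of the graph `T` has exactly one neighbour. -/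
def HasNoLeaf {V : Type*} (T : SimpleGraph V) : Prop :=
  ∀ x y : V, T.Adj x y → ∃ z, T.Adj x z ∧ z ≠ y

/-- The complement of the orbit of a leaf is an invariant subtree. -/
theorem IsMinimalTree.hasNoLeaf (hmin : IsMinimalTree Γ T) (hT : IsGroupTree Γ T)
    (hbip : IsAbelianBipartite Γ T) : HasNoLeaf T := by
  intro x y hxy
  by_contra! hx
  have hleaf : ∀ (g : Γ) (z : V), T.Adj (g • x) z → z = g • y := by
    intro g z hz
    rw [← hx (g⁻¹ • z) (by simpa using hT.adj_smul g⁻¹ _ _ hz), smul_inv_smul]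
  have hy : y ∉ MulAction.orbit Γ x := by
    rintro ⟨g, hg⟩
    exact hbip.smul_ne_of_adj hxy g hg
  have hconn : (T.induce (MulAction.orbit Γ x)ᶜ).Connected := by
    refine induce_connected_of_forall_exists_adj hy fun u _ huy => ?_
    obtain ⟨w, huw, hw⟩ := exists_adj_dist_add_one hT.isTree.connected huy
    refine ⟨w, ?_, huw, by lia⟩
    rintro ⟨g, rfl⟩
    obtain ⟨w', hgw', hw'⟩ := exists_adj_dist_add_one hT.isTree.connected
      (show g • x ≠ y from fun h => hy ⟨g, h⟩)
    rw [hleaf g w' hgw', ← hleaf g u huw.symm] at hw'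
    simp only at hw
    lia
  have huniv := hmin _ hconn fun g v hv hgv =>
    hv (by simpa using MulAction.mem_orbit_of_mem_orbit g⁻¹ hgv)
  exact (huniv ▸ Set.mem_univ x : x ∈ (MulAction.orbit Γ x)ᶜ) (MulAction.mem_orbit_self x)

end Colours

section PiecewiseTrivialSuspensions

variable {Γ : Type*} [Group Γ] {G : Subgroup Γ} {t : Γ} {V : Type*} [MulAction Γ V]
  {T : SimpleGraph V}

theorem IsInternalDirectProduct.exists_eq_mul {A B C : Subgroup Γ}
    (h : IsInternalDirectProduct C A B) {x : Γ} (hx : x ∈ C) : ∃ a ∈ A, ∃ b ∈ B, x = a * b := by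
  have hcomm : ∀ (a : A) (b : B), Commute (A.subtype a) (B.subtype b) :=
    fun a b => h.comm a a.2 b b.2
  rw [← h.sup_eq, ← A.range_subtype, ← B.range_subtype, ← MonoidHom.noncommCoprod_range _ _ hcomm]
    at hx
  obtain ⟨⟨a, b⟩, rfl⟩ := hx
  exact ⟨a, a.2, b, b.2, rfl⟩

theorem commute_of_commute_mul_inv {a b c : Γ} (hac : Commute a c) (hbc : Commute b c)
    (h : Commute (a * c⁻¹) (b * c⁻¹)) : Commute a b := by
  have hab : Commute (a * c⁻¹) b := by
    simpa using h.mul_right (hac.mul_left (Commute.refl c).inv_left)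
  simpa using hab.mul_left hbc.symm

namespace IsPiecewiseTrivialSuspension

/-- The element `t_v ∈ G t` that generates the cyclic factor of the stabilizer of `v`, chosen among
the possible ones. -/
noncomputable def gen (hT : IsPiecewiseTrivialSuspension G t T) (v : V) : Γ :=
  (hT.exists_central v).choose

theorem exists_gen_eq_mul (hT : IsPiecewiseTrivialSuspension G t T) (v : V) :
    ∃ g ∈ G, hT.gen v = g * t := (hT.exists_central v).choose_spec.1

theorem isInternalDirectProduct_stabilizer (hT : IsPiecewiseTrivialSuspension G t T) (v : V) :
    IsInternalDirectProduct (MulAction.stabilizer Γ v) (MulAction.stabilizer Γ v ⊓ G)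
      (Subgroup.zpowers (hT.gen v)) := (hT.exists_central v).choose_spec.2.1

theorem gen_zpow_smul_eq_iff (hT : IsPiecewiseTrivialSuspension G t T) {v : V}
    (hv : ¬ IsBlack Γ v) {n : ℤ} (hn : n ≠ 0) (w : V) :
    hT.gen v ^ n • w = w ↔ T.dist v w ≤ 2 :=
  (hT.exists_central v).choose_spec.2.2 hv n hn w

theorem gen_smul_eq_iff (hT : IsPiecewiseTrivialSuspension G t T) {v : V} (hv : ¬ IsBlack Γ v)
    (w : V) : hT.gen v • w = w ↔ T.dist v w ≤ 2 := by
  simpa using hT.gen_zpow_smul_eq_iff hv one_ne_zero w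

theorem gen_smul_of_adj (hT : IsPiecewiseTrivialSuspension G t T) {v w : V}
    (hv : ¬ IsBlack Γ v) (hvw : T.Adj v w) : hT.gen v • w = w :=
  (hT.gen_smul_eq_iff hv w).2 (by simp [SimpleGraph.dist_eq_one_iff_adj.2 hvw])

theorem gen_ne_one (hT : IsPiecewiseTrivialSuspension G t T) (ht : t ∉ G) (v : V) :
    hT.gen v ≠ 1 := by
  obtain ⟨g, hg, hgen⟩ := hT.exists_gen_eq_mul v
  intro h
  rw [h, eq_comm, mul_eq_one_iff_inv_eq] at hgen
  exact ht (hgen ▸ G.inv_mem hg)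

theorem gen_mul_inv_gen_mem (hT : IsPiecewiseTrivialSuspension G t T) (v w : V) :
    hT.gen v * (hT.gen w)⁻¹ ∈ G := by
  obtain ⟨g, hg, hgen⟩ := hT.exists_gen_eq_mul v
  obtain ⟨g', hg', hgen'⟩ := hT.exists_gen_eq_mul w
  rw [hgen, hgen', mul_inv_rev, mul_assoc, mul_inv_cancel_left]
  exact G.mul_mem hg (G.inv_mem hg')

theorem exists_eq_mul_gen_zpow (hT : IsPiecewiseTrivialSuspension G t T) {v : V} {x : Γ}
    (hx : x • v = v) : ∃ g ∈ G, g • v = v ∧ ∃ n : ℤ, x = g * hT.gen v ^ n := by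
  obtain ⟨g, ⟨hgv, hg⟩, _, ⟨n, rfl⟩, rfl⟩ :=
    (hT.isInternalDirectProduct_stabilizer v).exists_eq_mul hx
  exact ⟨g, hg, hgv, n, rfl⟩

theorem commute_gen_of_smul_eq (hT : IsPiecewiseTrivialSuspension G t T) {v : V} {x : Γ}
    (hx : x • v = v) : Commute x (hT.gen v) := by
  obtain ⟨g, hg, hgv, n, rfl⟩ := hT.exists_eq_mul_gen_zpow hx
  have hcomm : Commute g (hT.gen v) :=
    (hT.isInternalDirectProduct_stabilizer v).comm g ⟨hgv, hg⟩ _ (Subgroup.mem_zpowers _)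
  exact hcomm.mul_left ((Commute.refl _).zpow_left n)

theorem eq_of_forall_dist_le_two (hT : IsPiecewiseTrivialSuspension G t T)
    (hleaf : HasNoLeaf T) {v w : V} (hv : ¬ IsBlack Γ v) (hw : ¬ IsBlack Γ w)
    (h : ∀ x, T.dist v x ≤ 2 → T.dist w x ≤ 2) : v = w := by
  by_contra hvw
  have htree := hT.isGroupTree.isTree
  obtain ⟨b, hvb, hb⟩ := exists_adj_dist_add_one htree.connected (r := w) hvw
  obtain ⟨c, hvc, hcb⟩ := hleaf v b hvb
  have hc := dist_eq_add_one_of_adj htree hvb hvc (r := w) (by lia) hcb.symm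
  have hc2 := h c (by simp [SimpleGraph.dist_eq_one_iff_adj.2 hvc])
  have hwv : T.Adj w v := SimpleGraph.dist_eq_one_iff_adj.1 (by lia)
  exact hv (hT.bipartite.isBlack hw hwv)

theorem commute_gen_zpow_iff (hT : IsPiecewiseTrivialSuspension G t T) (hleaf : HasNoLeaf T)
    {v : V} (hv : ¬ IsBlack Γ v) {n : ℤ} (hn : n ≠ 0) {z : Γ} :
    Commute z (hT.gen v ^ n) ↔ z • v = v := by
  refine ⟨fun hz => ?_, fun hz => (hT.commute_gen_of_smul_eq hz).zpow_right n⟩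
  refine hT.eq_of_forall_dist_le_two hleaf (by rwa [isBlack_smul_iff]) hv fun x hx => ?_
  obtain ⟨y, rfl⟩ := MulAction.surjective z x
  rw [hT.isGroupTree.dist_smul, ← hT.gen_zpow_smul_eq_iff hv hn] at hx
  rw [← hT.gen_zpow_smul_eq_iff hv hn, ← mul_smul, ← hz.eq, mul_smul, hx]

theorem commute_gen_gen_iff (hT : IsPiecewiseTrivialSuspension G t T) (hleaf : HasNoLeaf T)
    {v w : V} (hv : ¬ IsBlack Γ v) (hw : ¬ IsBlack Γ w) :
    Commute (hT.gen v) (hT.gen w) ↔ T.dist v w ≤ 2 := by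
  rw [← hT.gen_smul_eq_iff hv, ← hT.commute_gen_zpow_iff hleaf hw one_ne_zero, zpow_one]

theorem eq_one_of_fix_two_edges (hT : IsPiecewiseTrivialSuspension G t T) (hleaf : HasNoLeaf T)
    (hG : IsCommutativeTransitive G) {v b c : V} (hv : ¬ IsBlack Γ v) (hvb : T.Adj v b)
    (hvc : T.Adj v c) (hbc : b ≠ c) {x : Γ} (hx : x ∈ G) (hxb : x • b = b) (hxc : x • c = c) :
    x = 1 := by
  by_contra hne
  have htree := hT.isGroupTree.isTree
  -- `x`, `t_v` and `t_w` lie in the stabilizer of `b`, which is abelian.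
  have exists_white : ∀ b, T.Adj v b → x • b = b → ∃ w, T.Adj b w ∧ w ≠ v ∧ ¬ IsBlack Γ w ∧
      Commute (hT.gen w) (hT.gen v) ∧ Commute (hT.gen w * (hT.gen v)⁻¹) x := by
    intro b hvb hxb
    obtain ⟨w, hbw, hwv⟩ := hleaf b v hvb.symm
    have hb := hT.bipartite.isBlack hv hvb
    have hw := hT.bipartite.not_isBlack hb hbw
    have hgv := hT.gen_smul_of_adj hv hvb
    have hgw := hT.gen_smul_of_adj hw hbw.symm
    exact ⟨w, hbw, hwv, hw, hb.commute hgw hgv,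
      (hb.commute hgw hxb).mul_left (hb.commute hgv hxb).inv_left⟩
  obtain ⟨w, hbw, hwv, hw, hwcomm, hwx⟩ := exists_white b hvb hxb
  obtain ⟨u, hcu, huv, hu, hucomm, hux⟩ := exists_white c hvc hxc
  have hgwu : Commute (hT.gen w) (hT.gen u) := commute_of_commute_mul_inv hwcomm hucomm <|
    hG.commute_of_mem hx (hT.gen_mul_inv_gen_mem w v) (hT.gen_mul_inv_gen_mem u v) hne hwx hux
  have hwu_le := (hT.commute_gen_gen_iff hleaf hw hu).1 hgwu
  have hwb : T.dist w b = 1 := SimpleGraph.dist_eq_one_iff_adj.2 hbw.symm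
  have hwv2 : T.dist w v = 2 := dist_eq_two htree hbw hvb.symm hwv
  have hwc := dist_eq_add_one_of_adj htree hvb hvc (r := w) (by lia) hbc
  have hwu := dist_eq_add_one_of_adj htree hvc.symm hcu (r := w) (by lia) huv.symm
  lia

theorem eq_one_of_fix_of_three_le_dist (hT : IsPiecewiseTrivialSuspension G t T)
    (hleaf : HasNoLeaf T) (hG : IsCommutativeTransitive G) {x : Γ} (hx : x ∈ G) {p q : V}
    (hpq : 3 ≤ T.dist q p) (hp : x • p = p) (hq : x • q = q) : x = 1 := by
  have exists_fixed : ∀ y, x • y = y → 0 < T.dist q y →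
      ∃ z, T.Adj y z ∧ T.dist q z + 1 = T.dist q y ∧ x • z = z := by
    intro y hy hqy
    obtain ⟨z, hyz, hz, hfix⟩ := hT.isGroupTree.exists_adj_fixed (show y ≠ q by
      rintro rfl
      simp at hqy)
    exact ⟨z, hyz, hz, hfix x hq hy⟩
  obtain ⟨a, hpa, hqa, ha⟩ := exists_fixed p hp (by lia)
  obtain ⟨b, hab, hqb, hb⟩ := exists_fixed a ha (by lia)
  obtain ⟨c, hbc, hqc, hc⟩ := exists_fixed b hb (by lia)
  by_cases hblack : IsBlack Γ a
  · exact hT.eq_one_of_fix_two_edges hleaf hG (hT.bipartite.not_isBlack hblack hab) hab.symm hbc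
      (by rintro rfl; lia) hx ha hc
  · exact hT.eq_one_of_fix_two_edges hleaf hG hblack hpa.symm hab (by rintro rfl; lia) hx hp hb

theorem exists_smul_eq_of_commute (hT : IsPiecewiseTrivialSuspension G t T)
    (hleaf : HasNoLeaf T) (hG : IsCommutativeTransitive G) (hcomm : commutator Γ ≤ G) {x a b : Γ}
    (ha : Commute a x) (hb : Commute b x) (hab : ¬ Commute a b) : ∃ u : V, x • u = u := by
  by_contra! hx
  obtain ⟨q, p, hqp, hq, hp⟩ := hT.isGroupTree.exists_commutator_smul_eq hx ha hb
  have hmem : ⁅a, b⁆ ∈ G :=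
    hcomm (Subgroup.commutator_mem_commutator (Subgroup.mem_top a) (Subgroup.mem_top b))
  exact hab <| commutatorElement_eq_one_iff_commute.1 <|
    hT.eq_one_of_fix_of_three_le_dist hleaf hG hmem hqp hp hq

theorem mem_zpowers_gen_of_fix_two_edges (hT : IsPiecewiseTrivialSuspension G t T)
    (hleaf : HasNoLeaf T) (hG : IsCommutativeTransitive G) {v b c : V} (hv : ¬ IsBlack Γ v)
    (hvb : T.Adj v b) (hvc : T.Adj v c) (hbc : b ≠ c) {x : Γ} (hxv : x • v = v)
    (hxb : x • b = b) (hxc : x • c = c) : x ∈ Subgroup.zpowers (hT.gen v) := by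
  obtain ⟨g, hg, -, n, rfl⟩ := hT.exists_eq_mul_gen_zpow hxv
  have hfix : ∀ a, T.Adj v a → (g * hT.gen v ^ n) • a = a → g • a = a := by
    intro a hva ha
    have hgen : hT.gen v ∈ MulAction.stabilizer Γ a := hT.gen_smul_of_adj hv hva
    rwa [mul_smul, MulAction.mem_stabilizer_iff.1 (zpow_mem hgen n)] at ha
  rw [hT.eq_one_of_fix_two_edges hleaf hG hv hvb hvc hbc hg (hfix b hvb hxb) (hfix c hvc hxc),
    one_mul]
  exact Subgroup.zpow_mem_zpowers _ n

theorem exists_mem_zpowers_gen_of_fix_two_black (hT : IsPiecewiseTrivialSuspension G t T)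
    (hleaf : HasNoLeaf T) (hG : IsCommutativeTransitive G) {b c : V} (hb : IsBlack Γ b)
    (hc : IsBlack Γ c) (hbc : b ≠ c) {x : Γ} (hxb : x • b = b) (hxc : x • c = c) :
    ∃ v : V, ¬ IsBlack Γ v ∧ x ∈ Subgroup.zpowers (hT.gen v) := by
  obtain ⟨v, hbv, hcv, hvfix⟩ := hT.isGroupTree.exists_adj_fixed hbc
  have hv := hT.bipartite.not_isBlack hb hbv
  obtain ⟨d, hvd, hcd, hdfix⟩ := hT.isGroupTree.exists_adj_fixed (show v ≠ c by
    rintro rfl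
    exact hv hc)
  have hxv := hvfix x hxc hxb
  exact ⟨v, hv, hT.mem_zpowers_gen_of_fix_two_edges hleaf hG hv hbv.symm hvd (by rintro rfl; lia)
    hxv hxb (hdfix x hxc hxv)⟩

theorem exists_forall_commute_smul_eq (hT : IsPiecewiseTrivialSuspension G t T)
    (hleaf : HasNoLeaf T) (hG : IsCommutativeTransitive G) {x : Γ}
    (hx : ∀ v : V, ¬ IsBlack Γ v → x ∉ Subgroup.zpowers (hT.gen v)) {u : V} (hu : x • u = u) :
    ∃ u : V, x • u = u ∧ ∀ z, Commute z x → z • u = u := by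
  have hmove : ∀ z, Commute z x → ∀ v : V, x • v = v → x • z • v = z • v := fun z hz v hv => by
    rw [← mul_smul, ← hz.eq, mul_smul, hv]
  by_cases hblack : ∃ b : V, IsBlack Γ b ∧ x • b = b
  · obtain ⟨b, hb, hxb⟩ := hblack
    refine ⟨b, hxb, fun z hz => ?_⟩
    by_contra hzb
    obtain ⟨v, hv, hxv⟩ := hT.exists_mem_zpowers_gen_of_fix_two_black hleaf hG
      ((isBlack_smul_iff z b).2 hb) hb hzb (hmove z hz b hxb) hxb
    exact hx v hv hxv
  · push Not at hblack
    refine ⟨u, hu, fun z hz => ?_⟩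
    by_contra hzu
    obtain ⟨b, hub, -, hb⟩ := hT.isGroupTree.exists_adj_fixed (Ne.symm hzu)
    exact hblack b (hT.bipartite.isBlack (fun h => hblack u h hu) hub)
      (hb x (hmove z hz u hu) hu)

theorem commute_of_notMem_zpowers_gen (hT : IsPiecewiseTrivialSuspension G t T)
    (hG : IsCommutativeTransitive G) {v : V} {x y z : Γ} (hx : x • v = v) (hy : y • v = v)
    (hz : z • v = v) (hyx : Commute y x) (hzx : Commute z x)
    (hxgen : x ∉ Subgroup.zpowers (hT.gen v)) : Commute y z := by
  obtain ⟨g, hg, hgv, n, rfl⟩ := hT.exists_eq_mul_gen_zpow hx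
  have hne : g ≠ 1 := by
    rintro rfl
    exact hxgen (by simp)
  have exists_commute : ∀ y, y • v = v → Commute y (g * hT.gen v ^ n) →
      ∃ k ∈ G, k • v = v ∧ Commute k g ∧ ∃ m : ℤ, y = k * hT.gen v ^ m := by
    intro y hy hyx
    obtain ⟨k, hk, hkv, m, rfl⟩ := hT.exists_eq_mul_gen_zpow hy
    have hyg : Commute (k * hT.gen v ^ m) g := by
      simpa using hyx.mul_right ((hT.commute_gen_of_smul_eq hy).zpow_right n).inv_right
    refine ⟨k, hk, hkv, ?_, m, rfl⟩
    simpa using hyg.mul_left ((hT.commute_gen_of_smul_eq hgv).zpow_right m).inv_right.symm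
  obtain ⟨k, hk, hkv, hkg, m, rfl⟩ := exists_commute y hy hyx
  obtain ⟨k', hk', hkv', hkg', m', rfl⟩ := exists_commute z hz hzx
  have hkgen := (hT.commute_gen_of_smul_eq hkv).zpow_right m'
  have hkgen' := ((hT.commute_gen_of_smul_eq hkv').zpow_right m).symm
  exact ((hG.commute_of_mem hg hk hk' hne hkg hkg').mul_right hkgen).mul_left
    (hkgen'.mul_right ((Commute.refl _).zpow_zpow m m'))

theorem exists_eq_gen_zpow (hT : IsPiecewiseTrivialSuspension G t T) (hleaf : HasNoLeaf T)
    (hG : IsCommutativeTransitive G) (hcomm : commutator Γ ≤ G) {x a b : Γ} (hx : x ≠ 1)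
    (ha : Commute a x) (hb : Commute b x) (hab : ¬ Commute a b) :
    ∃ v : V, ¬ IsBlack Γ v ∧ ∃ n : ℤ, n ≠ 0 ∧ x = hT.gen v ^ n := by
  suffices ∃ v : V, ¬ IsBlack Γ v ∧ x ∈ Subgroup.zpowers (hT.gen v) by
    obtain ⟨v, hv, n, rfl⟩ := this
    exact ⟨v, hv, n, by rintro rfl; simp at hx, rfl⟩
  by_contra! hgen
  obtain ⟨u₀, hu₀⟩ := hT.exists_smul_eq_of_commute hleaf hG hcomm ha hb hab
  obtain ⟨u, hu, hfix⟩ := hT.exists_forall_commute_smul_eq hleaf hG hgen hu₀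
  by_cases hblack : IsBlack Γ u
  · exact hab (hblack.commute (hfix a ha) (hfix b hb))
  · exact hab (hT.commute_of_notMem_zpowers_gen hG hu (hfix a ha) (hfix b hb) ha hb
      (hgen u hblack))

end IsPiecewiseTrivialSuspension

end PiecewiseTrivialSuspensions

section Stars

open scoped Pointwise

variable {Γ : Type*} [Group Γ] {V : Type*} [MulAction Γ V] {T : SimpleGraph V}

theorem exists_adj_adj_of_dist_le_two (hT : T.Connected) {v w : V} (hvw : v ≠ w)
    (hadj : ¬ T.Adj v w) (h : T.dist v w ≤ 2) : ∃ b, T.Adj b v ∧ T.Adj b w := by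
  obtain ⟨b, hvb, hb⟩ := exists_adj_dist_add_one hT hvw
  rw [T.dist_comm] at h
  refine ⟨b, hvb.symm, (SimpleGraph.dist_eq_one_iff_adj.1 (le_antisymm (by lia) ?_)).symm⟩
  exact hT.pos_dist_of_ne fun hwb => hadj (hwb ▸ hvb)

theorem adj_of_dist_le_two (hT : T.IsTree) {b u v w : V} (hu : T.Adj b u) (hv : T.Adj b v)
    (huv : u ≠ v) (hwb : w ≠ b) (hwu : T.dist w u ≤ 2) (hwv : T.dist w v ≤ 2) : T.Adj b w := by
  have hub := hT.dist_eq_dist_add_one_of_adj w hu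
  have hvb := hT.dist_eq_dist_add_one_of_adj w hv
  have hle : T.dist w b ≤ 1 := by
    by_contra h
    exact huv (eq_of_adj_of_dist_lt hT (r := w) hu hv (by lia) (by lia))
  exact (SimpleGraph.dist_eq_one_iff_adj.1 (hle.antisymm (hT.connected.pos_dist_of_ne hwb))).symm

theorem HasNoLeaf.exists_adj_adj (hleaf : HasNoLeaf T) (hT : T.Connected) {b v : V} (hbv : b ≠ v) :
    ∃ x y, T.Adj b x ∧ T.Adj b y ∧ x ≠ y := by
  obtain ⟨x, hbx, -⟩ := exists_adj_dist_add_one hT hbv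
  obtain ⟨y, hby, hyx⟩ := hleaf b x hbx
  exact ⟨x, y, hbx, hby, hyx.symm⟩

/-- The stabilizers of the white vertices at distance at most `1` from `v`, an encoding of `v`
inside the group. -/
def whiteStar (Γ : Type*) [Group Γ] {V : Type*} [MulAction Γ V] (T : SimpleGraph V) (v : V) :
    Set (Subgroup Γ) :=
  MulAction.stabilizer Γ '' {a | ¬ IsBlack Γ a ∧ (a = v ∨ T.Adj v a)}

theorem stabilizer_mem_whiteStar_iff (hT : IsGroupTree Γ T) (hbip : IsAbelianBipartite Γ T)
    {a v : V} (ha : ¬ IsBlack Γ a) :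
    MulAction.stabilizer Γ a ∈ whiteStar Γ T v ↔ a = v ∨ T.Adj v a := by
  refine ⟨?_, fun h => ⟨a, ⟨ha, h⟩, rfl⟩⟩
  rintro ⟨c, ⟨-, hcv⟩, hca⟩
  rwa [hbip.eq_of_stabilizer_le hT ha hca.ge]

theorem whiteStar_eq_singleton (hbip : IsAbelianBipartite Γ T) {v : V} (hv : ¬ IsBlack Γ v) :
    whiteStar Γ T v = {MulAction.stabilizer Γ v} := by
  have : {a | ¬ IsBlack Γ a ∧ (a = v ∨ T.Adj v a)} = {v} := by
    refine Set.eq_singleton_iff_unique_mem.2 ⟨⟨hv, Or.inl rfl⟩, ?_⟩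
    rintro a ⟨ha, rfl | hva⟩
    · rfl
    · exact absurd (hbip.isBlack hv hva) ha
  rw [whiteStar, this, Set.image_singleton]

theorem whiteStar_smul (hT : IsGroupTree Γ T) (g : Γ) (v : V) :
    whiteStar Γ T (g • v) = MulAut.conj g • whiteStar Γ T v := by
  have hstar : {a | ¬ IsBlack Γ a ∧ (a = g • v ∨ T.Adj (g • v) a)} =
      (g • ·) '' {a | ¬ IsBlack Γ a ∧ (a = v ∨ T.Adj v a)} := by
    ext a
    obtain ⟨a, rfl⟩ := MulAction.surjective g a
    simp [isBlack_smul_iff, hT.adj_smul_iff]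
  rw [whiteStar, hstar, Set.image_image, whiteStar, ← Set.image_smul, Set.image_image]
  exact Set.image_congr fun a _ => MulAction.stabilizer_smul_eq_stabilizer_map_conj g a

theorem whiteStar_subset_iff (hT : IsGroupTree Γ T) (hbip : IsAbelianBipartite Γ T)
    (hleaf : HasNoLeaf T) {v w : V} (hvw : v ≠ w) :
    whiteStar Γ T v ⊆ whiteStar Γ T w ↔ ¬ IsBlack Γ v ∧ T.Adj v w := by
  constructor
  · intro h
    by_cases hv : IsBlack Γ v
    · obtain ⟨x, y, hvx, hvy, hxy⟩ := hleaf.exists_adj_adj hT.isTree.connected hvw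
      have hnear : ∀ a, T.Adj v a → a = w ∨ T.Adj w a := fun a hva =>
        have ha := hbip.not_isBlack hv hva
        (stabilizer_mem_whiteStar_iff hT hbip ha).1
          (h ((stabilizer_mem_whiteStar_iff hT hbip ha).2 (Or.inr hva)))
      have hdist : ∀ a, T.Adj v a → T.dist w a ≤ 2 := by
        intro a hva
        rcases hnear a hva with rfl | hwa
        · simp
        · simp [SimpleGraph.dist_eq_one_iff_adj.2 hwa]
      have hw := hbip.not_isBlack hv <|
        adj_of_dist_le_two hT.isTree hvx hvy hxy hvw.symm (hdist x hvx) (hdist y hvy)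
      have eq_w : ∀ a, T.Adj v a → a = w := fun a hva =>
        (hnear a hva).resolve_right fun hwa => hbip.not_isBlack hv hva (hbip.isBlack hw hwa)
      exact absurd ((eq_w x hvx).trans (eq_w y hvy).symm) hxy
    · rw [whiteStar_eq_singleton hbip hv, Set.singleton_subset_iff,
        stabilizer_mem_whiteStar_iff hT hbip hv] at h
      exact ⟨hv, (h.resolve_left hvw).symm⟩
  · rintro ⟨hv, hadj⟩
    rw [whiteStar_eq_singleton hbip hv, Set.singleton_subset_iff,
      stabilizer_mem_whiteStar_iff hT hbip hv]
    exact Or.inr hadj.symm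

theorem whiteStar_injective (hT : IsGroupTree Γ T) (hbip : IsAbelianBipartite Γ T)
    (hleaf : HasNoLeaf T) : Function.Injective (whiteStar Γ T) := by
  intro v w h
  by_contra hvw
  obtain ⟨hv, hadj⟩ := (whiteStar_subset_iff hT hbip hleaf hvw).1 h.subset
  exact ((whiteStar_subset_iff hT hbip hleaf (Ne.symm hvw)).1 h.superset).1 (hbip.isBlack hv hadj)

theorem whiteStar_ssubset_iff (hT : IsGroupTree Γ T) (hbip : IsAbelianBipartite Γ T)
    (hleaf : HasNoLeaf T) {v w : V} :
    whiteStar Γ T v ⊂ whiteStar Γ T w ↔ ¬ IsBlack Γ v ∧ T.Adj v w := by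
  rw [Set.ssubset_iff_subset_ne, (whiteStar_injective hT hbip hleaf).ne_iff]
  refine ⟨fun h => (whiteStar_subset_iff hT hbip hleaf h.2).1 h.1, fun h => ?_⟩
  exact ⟨(whiteStar_subset_iff hT hbip hleaf h.2.ne).2 h, h.2.ne⟩

theorem adj_iff_whiteStar_ssubset (hT : IsGroupTree Γ T) (hbip : IsAbelianBipartite Γ T)
    (hleaf : HasNoLeaf T) {v w : V} :
    T.Adj v w ↔ whiteStar Γ T v ⊂ whiteStar Γ T w ∨ whiteStar Γ T w ⊂ whiteStar Γ T v := by
  rw [whiteStar_ssubset_iff hT hbip hleaf, whiteStar_ssubset_iff hT hbip hleaf, T.adj_comm w v]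
  have := hbip v w
  tauto

end Stars

section Reconstruction

open scoped Pointwise

/-- The nonabelian centralizers of nontrivial elements of `Γ`. If `Γ` is a piecewise trivial
suspension, these are the stabilizers of the white vertices. -/
def nonabelianCentralizers (Γ : Type*) [Group Γ] : Set (Subgroup Γ) :=
  {H | ¬ IsMulCommutative H ∧ ∃ x ≠ 1, Subgroup.centralizer {x} = H}

/-- `H` is the centralizer of a nontrivial element of `K`. For stabilizers of white vertices this
means that the vertices are at distance at most `2`. -/
def IsNear {Γ : Type*} [Group Γ] (H K : Subgroup Γ) : Prop :=
  ∃ x ≠ 1, Subgroup.centralizer {x} = H ∧ x ∈ K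

/-- A set of nonabelian centralizers any two of which are near, such as the set of stabilizers of
the neighbours of a black vertex. -/
structure IsNearClique {Γ : Type*} [Group Γ] (C : Set (Subgroup Γ)) : Prop where
  subset : C ⊆ nonabelianCentralizers Γ
  isNear : ∀ H ∈ C, ∀ K ∈ C, IsNear H K

/-- The sets of subgroups that encode the vertices: white vertices correspond to the singletons,
black ones to the maximal cliques. -/
def vertexStars (Γ : Type*) [Group Γ] : Set (Set (Subgroup Γ)) :=
  {S | (∃ H ∈ nonabelianCentralizers Γ, S = {H}) ∨ Maximal IsNearClique S}

namespace IsPiecewiseTrivialSuspension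

variable {Γ : Type*} [Group Γ] {G : Subgroup Γ} {t : Γ} {V : Type*} [MulAction Γ V]
  {T : SimpleGraph V}

theorem centralizer_gen_zpow (hT : IsPiecewiseTrivialSuspension G t T) (hleaf : HasNoLeaf T)
    {v : V} (hv : ¬ IsBlack Γ v) {n : ℤ} (hn : n ≠ 0) :
    Subgroup.centralizer {hT.gen v ^ n} = MulAction.stabilizer Γ v := by
  ext z
  exact Subgroup.mem_centralizer_singleton_iff.trans (hT.commute_gen_zpow_iff hleaf hv hn)

theorem centralizer_gen (hT : IsPiecewiseTrivialSuspension G t T) (hleaf : HasNoLeaf T)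
    {v : V} (hv : ¬ IsBlack Γ v) :
    Subgroup.centralizer {hT.gen v} = MulAction.stabilizer Γ v := by
  simpa using hT.centralizer_gen_zpow hleaf hv one_ne_zero

theorem exists_eq_gen_zpow_of_centralizer (hT : IsPiecewiseTrivialSuspension G t T)
    (hleaf : HasNoLeaf T) (hG : IsCommutativeTransitive G) (hcomm : commutator Γ ≤ G) {x : Γ}
    (hx : x ≠ 1) (hcent : ¬ IsMulCommutative (Subgroup.centralizer {x})) :
    ∃ v : V, ¬ IsBlack Γ v ∧ ∃ n : ℤ, n ≠ 0 ∧ x = hT.gen v ^ n := by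
  simp only [isMulCommutative_iff, Subtype.forall, Subgroup.mem_centralizer_singleton_iff,
    MulMemClass.mk_mul_mk, Subtype.mk.injEq, not_forall] at hcent
  obtain ⟨a, ha, b, hb, hab⟩ := hcent
  exact hT.exists_eq_gen_zpow hleaf hG hcomm hx ha hb hab

theorem mem_nonabelianCentralizers_iff (hT : IsPiecewiseTrivialSuspension G t T)
    (hleaf : HasNoLeaf T) (hG : IsCommutativeTransitive G) (hcomm : commutator Γ ≤ G)
    (ht : t ∉ G) {H : Subgroup Γ} :
    H ∈ nonabelianCentralizers Γ ↔ ∃ v : V, ¬ IsBlack Γ v ∧ MulAction.stabilizer Γ v = H := by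
  constructor
  · rintro ⟨hH, x, hx, rfl⟩
    obtain ⟨v, hv, n, hn, rfl⟩ := hT.exists_eq_gen_zpow_of_centralizer hleaf hG hcomm hx hH
    exact ⟨v, hv, (hT.centralizer_gen_zpow hleaf hv hn).symm⟩
  · rintro ⟨v, hv, rfl⟩
    exact ⟨hv, hT.gen v, hT.gen_ne_one ht v, hT.centralizer_gen hleaf hv⟩

theorem isNear_stabilizer_iff (hT : IsPiecewiseTrivialSuspension G t T)
    (hleaf : HasNoLeaf T) (hG : IsCommutativeTransitive G) (hcomm : commutator Γ ≤ G)
    (ht : t ∉ G) {v w : V} (hv : ¬ IsBlack Γ v) :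
    IsNear (MulAction.stabilizer Γ v) (MulAction.stabilizer Γ w) ↔ T.dist v w ≤ 2 := by
  constructor
  · rintro ⟨x, hx, hxv, hxw⟩
    obtain ⟨u, hu, n, hn, rfl⟩ :=
      hT.exists_eq_gen_zpow_of_centralizer hleaf hG hcomm hx (hxv ▸ hv)
    rw [hT.centralizer_gen_zpow hleaf hu hn] at hxv
    rw [← hT.bipartite.eq_of_stabilizer_le hT.isGroupTree hu hxv.le]
    exact (hT.gen_zpow_smul_eq_iff hu hn w).1 hxw
  · intro h
    exact ⟨hT.gen v, hT.gen_ne_one ht v, hT.centralizer_gen hleaf hv,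
      (hT.gen_smul_eq_iff hv w).2 h⟩

theorem isNearClique_whiteStar (hT : IsPiecewiseTrivialSuspension G t T)
    (hleaf : HasNoLeaf T) (hG : IsCommutativeTransitive G) (hcomm : commutator Γ ≤ G)
    (ht : t ∉ G) (v : V) : IsNearClique (whiteStar Γ T v) where
  subset := by
    rintro _ ⟨a, ⟨ha, -⟩, rfl⟩
    exact (hT.mem_nonabelianCentralizers_iff hleaf hG hcomm ht).2 ⟨a, ha, rfl⟩
  isNear := by
    have dist_le_one : ∀ a, a = v ∨ T.Adj v a → T.dist v a ≤ 1 := by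
      rintro a (rfl | h)
      · simp
      · exact (SimpleGraph.dist_eq_one_iff_adj.2 h).le
    rintro _ ⟨a, ⟨ha, hva⟩, rfl⟩ _ ⟨c, ⟨-, hvc⟩, rfl⟩
    rw [hT.isNear_stabilizer_iff hleaf hG hcomm ht ha]
    have := hT.isGroupTree.isTree.connected.dist_triangle (u := a) (v := v) (w := c)
    rw [T.dist_comm (u := a) (v := v)] at this
    have hda := dist_le_one a hva
    have hdc := dist_le_one c hvc
    lia

theorem subset_whiteStar_of_isNearClique (hT : IsPiecewiseTrivialSuspension G t T)
    (hleaf : HasNoLeaf T) (hG : IsCommutativeTransitive G) (hcomm : commutator Γ ≤ G)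
    (ht : t ∉ G) {b x y : V} (hb : IsBlack Γ b) (hbx : T.Adj b x) (hby : T.Adj b y) (hxy : x ≠ y)
    {C : Set (Subgroup Γ)} (hC : IsNearClique C) (hxC : MulAction.stabilizer Γ x ∈ C)
    (hyC : MulAction.stabilizer Γ y ∈ C) : C ⊆ whiteStar Γ T b := by
  intro H hH
  obtain ⟨a, ha, rfl⟩ := (hT.mem_nonabelianCentralizers_iff hleaf hG hcomm ht).1 (hC.subset hH)
  have dist_le : ∀ z, MulAction.stabilizer Γ z ∈ C → T.dist a z ≤ 2 := fun z hz =>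
    (hT.isNear_stabilizer_iff hleaf hG hcomm ht ha).1 (hC.isNear _ hH _ hz)
  refine ⟨a, ⟨ha, Or.inr ?_⟩, rfl⟩
  exact adj_of_dist_le_two hT.isGroupTree.isTree hbx hby hxy (fun h => ha (h ▸ hb))
    (dist_le x hxC) (dist_le y hyC)

theorem whiteStar_mem_vertexStars (hT : IsPiecewiseTrivialSuspension G t T)
    (hleaf : HasNoLeaf T) (hG : IsCommutativeTransitive G) (hcomm : commutator Γ ≤ G)
    (ht : t ∉ G) (v : V) : whiteStar Γ T v ∈ vertexStars Γ := by
  by_cases hv : IsBlack Γ v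
  · refine Or.inr ⟨hT.isNearClique_whiteStar hleaf hG hcomm ht v, fun C hC hvC => ?_⟩
    intro H hH
    obtain ⟨a, ha, rfl⟩ := (hT.mem_nonabelianCentralizers_iff hleaf hG hcomm ht).1 (hC.subset hH)
    obtain ⟨x, y, hvx, hvy, hxy⟩ :=
      hleaf.exists_adj_adj hT.isGroupTree.isTree.connected (show v ≠ a from fun h => ha (h ▸ hv))
    have mem : ∀ z, T.Adj v z → MulAction.stabilizer Γ z ∈ C := fun z hvz =>
      hvC ⟨z, ⟨hT.bipartite.not_isBlack hv hvz, Or.inr hvz⟩, rfl⟩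
    exact hT.subset_whiteStar_of_isNearClique hleaf hG hcomm ht hv hvx hvy hxy hC (mem x hvx)
      (mem y hvy) hH
  · exact Or.inl ⟨_, (hT.mem_nonabelianCentralizers_iff hleaf hG hcomm ht).2 ⟨v, hv, rfl⟩,
      whiteStar_eq_singleton hT.bipartite hv⟩

theorem exists_whiteStar_eq_singleton (hT : IsPiecewiseTrivialSuspension G t T)
    (hleaf : HasNoLeaf T) (hG : IsCommutativeTransitive G) (hcomm : commutator Γ ≤ G)
    (ht : t ∉ G) {H : Subgroup Γ} (hH : H ∈ nonabelianCentralizers Γ) :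
    ∃ v : V, whiteStar Γ T v = {H} := by
  obtain ⟨v, hv, rfl⟩ := (hT.mem_nonabelianCentralizers_iff hleaf hG hcomm ht).1 hH
  exact ⟨v, whiteStar_eq_singleton hT.bipartite hv⟩

theorem exists_whiteStar_eq_of_maximal (hT : IsPiecewiseTrivialSuspension G t T)
    (hleaf : HasNoLeaf T) (hG : IsCommutativeTransitive G) (hcomm : commutator Γ ≤ G)
    (ht : t ∉ G) {S : Set (Subgroup Γ)} (hS : Maximal IsNearClique S) :
    ∃ v : V, whiteStar Γ T v = S := by
  have hclique := hT.isNearClique_whiteStar hleaf hG hcomm ht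
  rcases S.subsingleton_or_nontrivial with hsub | ⟨H, hH, K, hK, hHK⟩
  · obtain rfl | ⟨H, rfl⟩ := hsub.eq_empty_or_singleton
    · obtain ⟨v⟩ := hT.isGroupTree.isTree.connected.nonempty
      exact ⟨v, (hS.eq_of_subset (hclique v) (Set.empty_subset _)).symm⟩
    · exact hT.exists_whiteStar_eq_singleton hleaf hG hcomm ht (hS.prop.subset rfl)
  · have hwhite := fun L hL =>
      (hT.mem_nonabelianCentralizers_iff hleaf hG hcomm ht).1 (hS.prop.subset (a := L) hL)
    obtain ⟨v, hv, rfl⟩ := hwhite H hH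
    obtain ⟨w, hw, rfl⟩ := hwhite K hK
    have hdist := (hT.isNear_stabilizer_iff hleaf hG hcomm ht hv).1 (hS.prop.isNear _ hH _ hK)
    have hvw : v ≠ w := by
      rintro rfl
      exact hHK rfl
    obtain ⟨b, hbv, hbw⟩ := exists_adj_adj_of_dist_le_two hT.isGroupTree.isTree.connected hvw
      (fun h => hw (hT.bipartite.isBlack hv h)) hdist
    exact ⟨b, (hS.eq_of_subset (hclique b) <| hT.subset_whiteStar_of_isNearClique hleaf hG hcomm ht
      (hT.bipartite.isBlack hv hbv.symm) hbv hbw hvw hS.prop hH hK).symm⟩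

theorem range_whiteStar (hT : IsPiecewiseTrivialSuspension G t T)
    (hleaf : HasNoLeaf T) (hG : IsCommutativeTransitive G) (hcomm : commutator Γ ≤ G)
    (ht : t ∉ G) : Set.range (whiteStar Γ T) = vertexStars Γ := by
  ext S
  constructor
  · rintro ⟨v, rfl⟩
    exact hT.whiteStar_mem_vertexStars hleaf hG hcomm ht v
  · rintro (⟨H, hH, rfl⟩ | hS)
    · exact hT.exists_whiteStar_eq_singleton hleaf hG hcomm ht hH
    · exact hT.exists_whiteStar_eq_of_maximal hleaf hG hcomm ht hS

end IsPiecewiseTrivialSuspension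

variable {Γ : Type*} [Group Γ] {V V' : Type*} [MulAction Γ V] [MulAction Γ V']
  {T : SimpleGraph V} {T' : SimpleGraph V'}

theorem exists_equivariant_iso_of_range_whiteStar_eq (hT : IsGroupTree Γ T)
    (hT' : IsGroupTree Γ T') (hbip : IsAbelianBipartite Γ T) (hbip' : IsAbelianBipartite Γ T')
    (hleaf : HasNoLeaf T) (hleaf' : HasNoLeaf T')
    (h : Set.range (whiteStar Γ T) = Set.range (whiteStar Γ T')) :
    ∃ f : T ≃g T', ∀ (g : Γ) (v : V), f (g • v) = g • f v := by
  have hinj := whiteStar_injective hT hbip hleaf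
  have hinj' := whiteStar_injective hT' hbip' hleaf'
  let f : V ≃ V' := (Equiv.ofInjective _ hinj).trans <|
    (Equiv.setCongr h).trans (Equiv.ofInjective _ hinj').symm
  have hf : ∀ v, whiteStar Γ T' (f v) = whiteStar Γ T v := fun v =>
    Equiv.apply_ofInjective_symm hinj' _
  refine ⟨⟨f, fun {v w} => ?_⟩, fun g v => hinj' ?_⟩
  · rw [adj_iff_whiteStar_ssubset hT hbip hleaf, adj_iff_whiteStar_ssubset hT' hbip' hleaf', hf, hf]
  · change whiteStar Γ T' (f (g • v)) = whiteStar Γ T' (g • f v)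
    rw [hf, whiteStar_smul hT, whiteStar_smul hT', hf]

end Reconstruction

end PiecewiseTrivial

theorem mainTheorem7_general {Γ : Type*} [Group Γ] {G G' : Subgroup Γ}
    (hG : PiecewiseTrivial.IsCommutativeTransitive G)
    (hG' : PiecewiseTrivial.IsCommutativeTransitive G') (hcomm : commutator Γ ≤ G)
    (hcomm' : commutator Γ ≤ G') {t t' : Γ} (ht : t ∉ G) (ht' : t' ∉ G') {V V' : Type*}
    [MulAction Γ V] [MulAction Γ V'] {T : SimpleGraph V} {T' : SimpleGraph V'}
    (hT : PiecewiseTrivial.IsPiecewiseTrivialSuspension G t T)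
    (hT' : PiecewiseTrivial.IsPiecewiseTrivialSuspension G' t' T')
    (hleaf : PiecewiseTrivial.HasNoLeaf T) (hleaf' : PiecewiseTrivial.HasNoLeaf T') :
    ∃ f : T ≃g T', ∀ (g : Γ) (v : V), f (g • v) = g • f v :=
  PiecewiseTrivial.exists_equivariant_iso_of_range_whiteStar_eq hT.isGroupTree hT'.isGroupTree
    hT.bipartite hT'.bipartite hleaf hleaf' <|
    (hT.range_whiteStar hleaf hG hcomm ht).trans (hT'.range_whiteStar hleaf' hG' hcomm' ht').symm

theorem mainTheorem7 {Γ : Type*} [Group Γ]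
    (G G' : Subgroup Γ) (hG : PiecewiseTrivial.IsCSA G) (hG' : PiecewiseTrivial.IsCSA G')
    (α : MulAut G) (t : Γ) (hs : PiecewiseTrivial.IsSuspension G α t)
    (α' : MulAut G') (t' : Γ) (hs' : PiecewiseTrivial.IsSuspension G' α' t')
    {V V' : Type*} [MulAction Γ V] [MulAction Γ V']
    (T : SimpleGraph V) (T' : SimpleGraph V')
    (hT : PiecewiseTrivial.IsPiecewiseTrivialSuspension G t T)
    (hT' : PiecewiseTrivial.IsPiecewiseTrivialSuspension G' t' T')
    (hmin : PiecewiseTrivial.IsMinimalTree Γ T) (hmin' : PiecewiseTrivial.IsMinimalTree Γ T') :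
    ∃ f : T ≃g T', ∀ (g : Γ) (v : V), f (g • v) = g • f v :=
  mainTheorem7_general hG.isCommutativeTransitive hG'.isCommutativeTransitive hs.commutator_le
    hs'.commutator_le hs.notMem hs'.notMem hT hT' (hmin.hasNoLeaf hT.isGroupTree hT.bipartite)
    (hmin'.hasNoLeaf hT'.isGroupTree hT'.bipartite)
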